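/- Let $\mathcal H$ be a complex Hilbert space of dimension $n$, let $\psi_1,\dots,\psi_n\in\mathcal H$ be linearly independent unit vectors and let $p_1,\dots,p_n>0$ with $\sum_i p_i=1$. Put $\tilde\psi_i=\sqrt{p_i}\,\psi_i$, let $G$ be the Gram matrix $G_{ij}=\langle\tilde\psi_i,\tilde\psi_j\rangle$ (inner products are linear in the second argument), and let $\tilde u_1,\dots,\tilde u_n$ be the dual vectors, determined by $\langle\tilde\psi_i,\tilde u_j\rangle=\delta_{ij}$. An $n$-POVM is a family $E=(E_i)_{i=1}^n$ of positive semidefinite operators on $\mathcal H$ with $\sum_i E_i=\mathbb 1$; it is optimal for minimum-error discrimination of the ensemble $\{p_i,|\psi_i\rangle\langle\psi_i|\}_{i=1}^n$ if it maximizes the success probability $\sum_i p_i\langle\psi_i,E_i\psi_i\rangle$ among all $n$-POVMs. For a positive definite Hermitian $n\times n$ matrix $X$ let $D_X$ be the diagonal matrix with entries $\sqrt{X_{ii}}$. Call $X$ a positive definite solution if $$X^2=D_X\,G\,D_X ,$$ and put $w_i^X=\sum_{j=1}^n (D_X^{-1}X)_{ji}\,\tilde u_j$. Then: 1. If $X$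 is a positive definite solution, then $(w_i^X)_{i=1}^n$ is an orthonormal basis of $\mathcal H$, and $(|w_i^X\rangle\langle w_i^X|)_{i=1}^n$ is an optimal POVM and the only one. 2. There is at most one positive definite solution $X$. 3. An $n$-POVM $E$ is optimal if and only if there is a positive definite solution $X$ with $E_i=|w_i^X\rangle\langle w_i^X|$ for all $i$. (The equation for $X$ involves the ensemble only through $G$, hence is invariant under unitary transformations of the states.) -/

import Mathlib

open scoped ComplexOrder InnerProductSpace

namespace MED

noncomputable section

variable {n : ℕ} {H : Type*} [NormedAddCommGroup H] [InnerProductSpace ℂ H]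

/-- An `n`-element POVM on `H`: positive operators that sum to the identity. -/
structure IsPOVM (E : Fin n → H →L[ℂ] H) : Prop where
  isPositive : ∀ i, (E i).IsPositive
  sum_eq_one : ∑ i, E i = 1

/-- Average probability of success `∑ i, p i ⟨ψ i| E i |ψ i⟩`. -/
def successProb (p : Fin n → ℝ) (ψ : Fin n → H) (E : Fin n → H →L[ℂ] H) : ℝ :=
  ∑ i, p i * (⟪ψ i, E i (ψ i)⟫_ℂ).re

/-- `E` is an optimal POVM for minimum-error discrimination of `{p i, |ψ i⟩⟨ψ i|}`: it maximizes
the success probability (equivalently, minimizes the error probability) among all `n`-POVMs. -/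
def IsOptimalPOVM (p : Fin n → ℝ) (ψ : Fin n → H) (E : Fin n → H →L[ℂ] H) : Prop :=
  IsPOVM E ∧ ∀ F : Fin n → H →L[ℂ] H, IsPOVM F → successProb p ψ F ≤ successProb p ψ E

/-- The subnormalized states `√(p i) |ψ i⟩`. -/
def scaledState (p : Fin n → ℝ) (ψ : Fin n → H) (i : Fin n) : H :=
  ((√(p i) : ℝ) : ℂ) • ψ i

/-- The Gram matrix `G i j = √(p i * p j) ⟨ψ i|ψ j⟩` of the ensemble. -/
def gramMatrix (p : Fin n → ℝ) (ψ : Fin n → H) : Matrix (Fin n) (Fin n) ℂ :=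
  Matrix.gram ℂ (scaledState p ψ)

/-- The vectors dual to the subnormalized states, `u k = ∑ j, (G⁻¹) j k • √(p j) |ψ j⟩`;
see `inner_scaledState_dualState`. -/
def dualState (p : Fin n → ℝ) (ψ : Fin n → H) (k : Fin n) : H :=
  ∑ j, (gramMatrix p ψ)⁻¹ j k • scaledState p ψ j

/-- The nonnegative real diagonal matrix `D` whose square is the diagonal of `X`
(for `X` with nonnegative real diagonal). -/
def sqrtDiag (X : Matrix (Fin n) (Fin n) ℂ) : Matrix (Fin n) (Fin n) ℂ :=
  Matrix.diagonal fun i => ((√(X i i).re : ℝ) : ℂ)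

/-- `X` is a positive definite (Hermitian) solution of `X² = D G D`, where `D ≥ 0` is the diagonal
matrix such that `D²` is the diagonal of `X`. -/
structure IsPosDefSolution (G X : Matrix (Fin n) (Fin n) ℂ) : Prop where
  posDef : X.PosDef
  sq_eq : X ^ 2 = sqrtDiag X * G * sqrtDiag X

/-- The vectors `w i = ∑ j, (D⁻¹ X) j i • u j` that correspond to `X`. -/
def basisOf (p : Fin n → ℝ) (ψ : Fin n → H) (X : Matrix (Fin n) (Fin n) ℂ) (i : Fin n) : H :=
  ∑ j, ((sqrtDiag X)⁻¹ * X) j i • dualState p ψ j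

/-- The family `|w i⟩⟨w i|`. -/
def rankOneFamily (w : Fin n → H) (i : Fin n) : H →L[ℂ] H :=
  InnerProductSpace.rankOne ℂ (w i) (w i)

theorem linearIndependent_scaledState {p : Fin n → ℝ} {ψ : Fin n → H} (hp : ∀ i, 0 < p i)
    (hψ : LinearIndependent ℂ ψ) : LinearIndependent ℂ (scaledState p ψ) := by
  have h : ∀ i, ((√(p i) : ℝ) : ℂ) ≠ 0 := fun i => by
    exact_mod_cast (Real.sqrt_pos.2 (hp i)).ne'
  exact hψ.units_smul fun i => Units.mk0 _ (h i)

/-- `dualState` is the family biorthogonal to the subnormalized states. -/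
theorem inner_scaledState_dualState {p : Fin n → ℝ} {ψ : Fin n → H} (hp : ∀ i, 0 < p i)
    (hψ : LinearIndependent ℂ ψ) (i k : Fin n) :
    ⟪scaledState p ψ i, dualState p ψ k⟫_ℂ = if i = k then 1 else 0 := by
  have hG : (gramMatrix p ψ).PosDef :=
    Matrix.posDef_gram_of_linearIndependent (linearIndependent_scaledState hp hψ)
  have h : gramMatrix p ψ * (gramMatrix p ψ)⁻¹ = 1 :=
    Matrix.mul_nonsing_inv _ ((Matrix.isUnit_iff_isUnit_det _).1 hG.isUnit)
  have h' := congrFun (congrFun h i) k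
  rw [Matrix.one_apply, Matrix.mul_apply] at h'
  rw [← h', dualState, inner_sum]
  refine Finset.sum_congr rfl fun j _ => ?_
  rw [inner_smul_right, mul_comm]
  rfl

end

end MED

/-! Write `φ i` for the scaled states. For a solution `X`, the vectors `b i = basisOf p ψ X i`
satisfy `X i k = d i * ⟪φ i, b k⟫` with `d i = ⟪φ i, b i⟫ > 0`, so `X` is the matrix in the basis
`b` of the Lagrange operator `∑ i, |b i⟩⟨b i|φ i⟩⟨φ i|`. If `f` is the matrix of `F i`, then `⟪φ i,
F i (φ i)⟫ = (X f X) i i / X i i ≤ tr (f X)`; summing over `i` bounds every success probability by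
`tr X`, which `b` attains. Equality forces `F i = |b i⟩⟨b i|` (`sum_re_inner_le_trace`), and this
POVM determines `X` (`IsPosDefSolution.eq_of_rankOneFamily_eq`).

The converse in part 3 needs a solution to exist. By compactness some orthonormal family `w`
maximizes `∑ i, |⟪φ i, w i⟫|²`. Testing it against phase rotations along one vector makes its
Lagrange operator positive (`overlapOperator_isPositive`), and testing it against transpositions
makes all overlaps nonzero (`overlap_pos`). The matrix of that operator is the solution. -/

namespace MED

/-! ### A trace inequality for positive definite matrices -/

section Matrix

open Matrix

variable {m : Type*} [Fintype m]

theorem eq_zero_of_conjTranspose_mul_mul_eq_zero {X N : Matrix m m ℂ} (hX : X.PosDef)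
    (h : Nᴴ * X * N = 0) : N = 0 := by
  classical
  have hcol : ∀ x : m → ℂ, N *ᵥ x = 0 := fun x => by
    by_contra hx
    refine (hX.dotProduct_mulVec_pos hx).ne' ?_
    rw [star_mulVec, mulVec_mulVec, ← dotProduct_mulVec, mulVec_mulVec, ← Matrix.mul_assoc, h]
    simp
  ext j k
  simpa using congrFun (hcol (Pi.single k 1)) j

variable [DecidableEq m]

/-- Completing the square in the form `X`: `1 - c • (P * X)` is the `X`-orthogonal projection that
kills `e i`, so it changes `Bᴴ` only in row `i`, and the part split off is the diagonal entry. -/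
theorem trace_mul_eq_inv_mul_add {X : Matrix m m ℂ} (hX : X.PosDef) (B : Matrix m m ℂ) (i : m) :
    ∃ N : Matrix m m ℂ, (∀ j ≠ i, N j = Bᴴ j) ∧
      (Bᴴ * B * X).trace = (X i i)⁻¹ * (X * (Bᴴ * B) * X) i i + (Nᴴ * X * N).trace := by
  set P : Matrix m m ℂ := Matrix.single i i 1 with hP
  have hXi : X i i ≠ 0 := (hX.diag_pos (i := i)).ne'
  set c : ℂ := (X i i)⁻¹ with hc
  have hcs : star c = c := by
    rw [hc, star_inv₀, hX.isHermitian.apply]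
  have hPH : Pᴴ = P := by simp [hP]
  have hPXP : P * X * P = X i i • P := by
    simp [hP, Matrix.smul_single]
  have hXH : Xᴴ = X := hX.isHermitian
  have hcX : c * X i i = 1 := inv_mul_cancel₀ hXi
  have hQ : (1 - c • (P * X))ᴴ * X * (1 - c • (P * X)) = X - c • (X * P * X) := by
    have h1 : X * P * X * (P * X) = X i i • (X * P * X) := by
      calc X * P * X * (P * X) = X * (P * X * P) * X := by simp only [Matrix.mul_assoc]
        _ = _ := by rw [hPXP]; simp
    rw [conjTranspose_sub, conjTranspose_one, conjTranspose_smul, conjTranspose_mul, hXH, hPH, hcs]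
    simp only [Matrix.sub_mul, Matrix.mul_sub, Matrix.one_mul, Matrix.mul_one, Matrix.smul_mul,
      Matrix.mul_smul, h1, smul_smul]
    rw [hcX, ← Matrix.mul_assoc, one_smul, sub_self, smul_zero, sub_zero]
  have hPtr : ∀ A : Matrix m m ℂ, (P * A).trace = A i i := fun A => by
    simp [hP, Matrix.trace_single_mul]
  refine ⟨(1 - c • (P * X)) * Bᴴ, fun j hj => ?_, ?_⟩
  · ext k
    rw [Matrix.sub_mul, Matrix.one_mul, Matrix.smul_mul, Matrix.mul_assoc]
    simp [hP, hj]
  · have h2 : ((1 - c • (P * X)) * Bᴴ)ᴴ * X * ((1 - c • (P * X)) * Bᴴ)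
        = B * ((1 - c • (P * X))ᴴ * X * (1 - c • (P * X))) * Bᴴ := by
      rw [conjTranspose_mul, conjTranspose_conjTranspose]
      simp only [Matrix.mul_assoc]
    rw [h2, hQ, Matrix.mul_sub, Matrix.sub_mul, trace_sub, Matrix.mul_smul, Matrix.smul_mul,
      trace_smul, smul_eq_mul]
    have h3 : (B * (X * P * X) * Bᴴ).trace = (X * (Bᴴ * B) * X) i i := by
      rw [← hPtr (X * (Bᴴ * B) * X), ← trace_mul_comm]
      calc (Bᴴ * (B * (X * P * X))).trace = ((Bᴴ * B * X) * (P * X)).trace := by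
            simp only [Matrix.mul_assoc]
        _ = _ := by rw [trace_mul_comm]; simp only [Matrix.mul_assoc]
    rw [h3, ← trace_mul_cycle, Matrix.mul_assoc B, trace_mul_comm B]
    simp only [Matrix.mul_assoc]
    rw [trace_mul_comm X]
    simp only [Matrix.mul_assoc]
    ring

/-- For `X` positive definite, `f` positive semidefinite:
`(X f X) i i / X i i ≤ tr (f X)`, and equality forces `f` to live in row `i`. -/
theorem inv_mul_apply_le_trace_mul {X f : Matrix m m ℂ} (hX : X.PosDef) (hf : f.PosSemidef)
    (i : m) :
    (X i i)⁻¹ * (X * f * X) i i ≤ (f * X).trace ∧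
      ((X i i)⁻¹ * (X * f * X) i i = (f * X).trace → ∀ j ≠ i, f j = 0) := by
  obtain ⟨B, rfl⟩ : ∃ B : Matrix m m ℂ, f = Bᴴ * B := by
    open scoped MatrixOrder in
    exact CStarAlgebra.nonneg_iff_eq_star_mul_self.mp hf.nonneg
  obtain ⟨N, hN, htr⟩ := trace_mul_eq_inv_mul_add hX B i
  have hpos : (Nᴴ * X * N).PosSemidef := hX.posSemidef.conjTranspose_mul_mul_same N
  refine ⟨by rw [htr]; exact le_add_of_nonneg_right hpos.trace_nonneg, fun h j hj => ?_⟩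
  -- Equality kills `N`, which agrees with `Bᴴ` off row `i`; so those rows of `Bᴴ * B` vanish.
  rw [htr, left_eq_add, hpos.trace_eq_zero_iff] at h
  have hN0 := eq_zero_of_conjTranspose_mul_mul_eq_zero hX h
  have hB : Bᴴ j = 0 := by rw [← hN j hj, hN0]; rfl
  funext k
  rw [Matrix.mul_apply]
  exact Finset.sum_eq_zero fun l _ => by rw [congrFun hB l, Pi.zero_apply, zero_mul]

end Matrix

/-! ### Optimality certificate -/

section Certificate

variable {n : ℕ} {H : Type*} [NormedAddCommGroup H] [InnerProductSpace ℂ H]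

theorem successProb_eq_sum_scaledState {p : Fin n → ℝ} (hp : ∀ i, 0 < p i) (ψ : Fin n → H)
    (E : Fin n → H →L[ℂ] H) :
    successProb p ψ E = ∑ i, (⟪scaledState p ψ i, E i (scaledState p ψ i)⟫_ℂ).re := by
  refine Finset.sum_congr rfl fun i _ => ?_
  rw [scaledState, map_smul, inner_smul_left, inner_smul_right, ← mul_assoc, Complex.conj_ofReal,
    ← Complex.ofReal_mul, Real.mul_self_sqrt (hp i).le, Complex.re_ofReal_mul]

theorem rankOneFamily_isPOVM (b : OrthonormalBasis (Fin n) ℂ H) : IsPOVM (rankOneFamily b) where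
  isPositive i := InnerProductSpace.isPositive_rankOne_self (b i)
  sum_eq_one := by
    ext x
    simpa [rankOneFamily] using b.sum_repr' x

theorem inner_apply_eq_sum (b : OrthonormalBasis (Fin n) ℂ H) (F : H →L[ℂ] H) (x : H) :
    ⟪x, F x⟫_ℂ = ∑ k, (∑ j, ⟪x, b j⟫_ℂ * ⟪b j, F (b k)⟫_ℂ) * ⟪b k, x⟫_ℂ := by
  have h : ∀ j, ⟪b j, F x⟫_ℂ = ∑ k, ⟪b j, F (b k)⟫_ℂ * ⟪b k, x⟫_ℂ := fun j => by
    conv_lhs => rw [← b.sum_repr' x]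
    simp only [map_sum, map_smul, inner_sum, inner_smul_right]
    exact Finset.sum_congr rfl fun k _ => mul_comm _ _
  rw [← b.sum_inner_mul_inner x (F x)]
  simp only [h, Finset.mul_sum, Finset.sum_mul, mul_assoc]
  exact Finset.sum_comm

variable {b : OrthonormalBasis (Fin n) ℂ H} {φ : Fin n → H} {X : Matrix (Fin n) (Fin n) ℂ}
  {d : Fin n → ℝ}

theorem sum_re_inner_rankOneFamily (hdφ : ∀ i, ⟪φ i, b i⟫_ℂ = d i)
    (hXφ : ∀ i k, X i k = d i * ⟪φ i, b k⟫_ℂ) :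
    ∑ i, (⟪φ i, rankOneFamily b i (φ i)⟫_ℂ).re = X.trace.re := by
  rw [Matrix.trace, Complex.re_sum]
  refine Finset.sum_congr rfl fun i _ => ?_
  rw [rankOneFamily, InnerProductSpace.rankOne_apply, inner_smul_right, ← inner_conj_symm,
    Matrix.diag_apply, hXφ, hdφ, Complex.conj_ofReal]

variable [FiniteDimensional ℂ H]

/-- Column `i` of `X` is `d i` times the coordinate vector of `φ i`, and `X i i = d i ^ 2`. -/
theorem inner_apply_eq_inv_mul (hX : X.PosDef) (hd : ∀ i, 0 < d i)
    (hdφ : ∀ i, ⟪φ i, b i⟫_ℂ = d i) (hXφ : ∀ i k, X i k = d i * ⟪φ i, b k⟫_ℂ)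
    (F : H →L[ℂ] H) (i : Fin n) :
    ⟪φ i, F (φ i)⟫_ℂ =
      (X i i)⁻¹ * (X * LinearMap.toMatrixOrthonormal b (F : H →ₗ[ℂ] H) * X) i i := by
  have hdi : (d i : ℂ) ≠ 0 := by exact_mod_cast (hd i).ne'
  have hX' : ∀ k, X k i = d i * ⟪b k, φ i⟫_ℂ := fun k => by
    rw [← hX.isHermitian.apply, hXφ, star_mul', Complex.star_def, Complex.conj_ofReal,
      inner_conj_symm]
  have h : (X * LinearMap.toMatrixOrthonormal b (F : H →ₗ[ℂ] H) * X) i i =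
      (d i * d i) * ⟪φ i, F (φ i)⟫_ℂ := by
    rw [inner_apply_eq_sum b, Matrix.mul_apply, Finset.mul_sum]
    refine Finset.sum_congr rfl fun k _ => ?_
    rw [Matrix.mul_apply, Finset.sum_mul, Finset.sum_mul, Finset.mul_sum]
    refine Finset.sum_congr rfl fun j _ => ?_
    rw [hX', hXφ, LinearMap.toMatrixOrthonormal_apply_apply]
    simp only [ContinuousLinearMap.coe_coe]
    ring
  rw [h, hXφ, hdφ]
  field_simp

/-- Only `F i` contributes to row `i` of the sum, so its row `i` is that of the identity. -/
theorem eq_rankOneFamily_of_toMatrixOrthonormal_row {F : Fin n → H →L[ℂ] H} (hF : IsPOVM F)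
    (h : ∀ i, ∀ j ≠ i, LinearMap.toMatrixOrthonormal b (F i : H →ₗ[ℂ] H) j = 0) :
    F = rankOneFamily b := by
  have hz : ∀ i j k, j ≠ i → ⟪b j, F i (b k)⟫_ℂ = 0 := fun i j k hj => by
    simpa [LinearMap.toMatrixOrthonormal_apply_apply] using congrFun (h i j hj) k
  have hsum : ∀ x, ∑ i, F i x = x := fun x => by
    simpa using congrArg (fun T : H →L[ℂ] H => T x) hF.sum_eq_one
  funext i
  have hdiag : ∀ k, ⟪b i, F i (b k)⟫_ℂ = ⟪b i, b k⟫_ℂ := fun k => by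
    conv_rhs => rw [← hsum (b k), inner_sum]
    exact (Finset.sum_eq_single i (fun l _ hl => hz l i k hl.symm) (by simp)).symm
  refine ContinuousLinearMap.coe_injective (b.toBasis.ext fun k => ?_)
  simp only [OrthonormalBasis.coe_toBasis, ContinuousLinearMap.coe_coe, rankOneFamily,
    InnerProductSpace.rankOne_apply]
  rw [← b.sum_repr' (F i (b k)), Finset.sum_eq_single i (fun j _ hj => by rw [hz i j k hj, zero_smul])
    (by simp), hdiag]

/-- Optimality certificate: if the operator `∑ i, |b i⟩⟨b i|φ i⟩⟨φ i|` has a positive definite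
matrix `X` in the basis `b`, its trace bounds the success probability of every POVM, with equality
only for the measurement in the basis `b`. -/
theorem sum_re_inner_le_trace (hX : X.PosDef) (hd : ∀ i, 0 < d i)
    (hdφ : ∀ i, ⟪φ i, b i⟫_ℂ = d i) (hXφ : ∀ i k, X i k = d i * ⟪φ i, b k⟫_ℂ)
    {F : Fin n → H →L[ℂ] H} (hF : IsPOVM F) :
    ∑ i, (⟪φ i, F i (φ i)⟫_ℂ).re ≤ X.trace.re ∧
      (∑ i, (⟪φ i, F i (φ i)⟫_ℂ).re = X.trace.re → F = rankOneFamily b) := by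
  set f : Fin n → Matrix (Fin n) (Fin n) ℂ :=
    fun i => LinearMap.toMatrixOrthonormal b (F i : H →ₗ[ℂ] H) with hf
  have hpsd : ∀ i, (f i).PosSemidef := fun i =>
    (LinearMap.posSemidef_toMatrix_iff b).2
      ((ContinuousLinearMap.isPositive_toLinearMap_iff _).2 (hF.isPositive i))
  have hsum : ∑ i, f i = 1 := by
    have h1 : ∑ i, (F i : H →ₗ[ℂ] H) = 1 := by
      ext x
      simpa using congrArg (fun T : H →L[ℂ] H => T x) hF.sum_eq_one
    rw [hf, ← map_sum, h1, map_one]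
  have htr : X.trace.re = ∑ i, ((f i * X).trace).re := by
    rw [← Complex.re_sum, ← Matrix.trace_sum, ← Finset.sum_mul, hsum, one_mul]
  have hle := fun i => inv_mul_apply_le_trace_mul hX (hpsd i) i
  have hle' : ∀ i ∈ Finset.univ, (⟪φ i, F i (φ i)⟫_ℂ).re ≤ ((f i * X).trace).re := fun i _ => by
    rw [inner_apply_eq_inv_mul hX hd hdφ hXφ]
    exact (Complex.le_def.1 (hle i).1).1
  rw [htr]
  refine ⟨Finset.sum_le_sum hle', fun heq => ?_⟩
  rw [Finset.sum_eq_sum_iff_of_le hle'] at heq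
  refine eq_rankOneFamily_of_toMatrixOrthonormal_row hF fun i => (hle i).2 ?_
  have hi := heq i (Finset.mem_univ i)
  rw [inner_apply_eq_inv_mul hX hd hdφ hXφ] at hi
  -- Comparability in `ℂ` already includes equality of imaginary parts.
  exact Complex.ext hi (Complex.le_def.1 (hle i).1).2

end Certificate

/-! ### From a solution to the optimal measurement -/

section Solution

variable {n : ℕ} {H : Type*} [NormedAddCommGroup H] [InnerProductSpace ℂ H]
  {p : Fin n → ℝ} {ψ : Fin n → H} {X : Matrix (Fin n) (Fin n) ℂ}

theorem inner_scaledState_sum_dualState (hp : ∀ i, 0 < p i) (hψ : LinearIndependent ℂ ψ)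
    (A : Matrix (Fin n) (Fin n) ℂ) (i k : Fin n) :
    ⟪scaledState p ψ i, ∑ j, A j k • dualState p ψ j⟫_ℂ = A i k := by
  simp [inner_scaledState_dualState hp hψ]

theorem gramMatrix_posDef (hp : ∀ i, 0 < p i) (hψ : LinearIndependent ℂ ψ) :
    (gramMatrix p ψ).PosDef :=
  Matrix.posDef_gram_of_linearIndependent (linearIndependent_scaledState hp hψ)

/-- The dual vectors have Gram matrix `G⁻¹`, so these combinations have Gram matrix `Aᴴ G⁻¹ A`. -/
theorem orthonormal_sum_dualState (hp : ∀ i, 0 < p i) (hψ : LinearIndependent ℂ ψ)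
    {A : Matrix (Fin n) (Fin n) ℂ} (hA : A * A.conjTranspose = gramMatrix p ψ) :
    Orthonormal ℂ (fun k => ∑ j, A j k • dualState p ψ j) := by
  have hG := gramMatrix_posDef hp hψ
  have hone : A.conjTranspose * (gramMatrix p ψ)⁻¹ * A = 1 := by
    rw [mul_eq_one_comm, ← Matrix.mul_assoc, hA]
    exact Matrix.mul_nonsing_inv _ ((Matrix.isUnit_iff_isUnit_det _).1 hG.isUnit)
  have hdual : ∀ j k, ⟪dualState p ψ j, ∑ l, A l k • dualState p ψ l⟫_ℂ =
      ((gramMatrix p ψ)⁻¹ * A) j k := fun j k => by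
    rw [dualState, sum_inner, Matrix.mul_apply]
    refine Finset.sum_congr rfl fun l _ => ?_
    rw [inner_smul_left, inner_scaledState_sum_dualState hp hψ, ← hG.inv.isHermitian.apply j l,
      Complex.star_def]
  rw [orthonormal_iff_ite]
  intro i k
  rw [sum_inner, ← Matrix.one_apply, ← hone, Matrix.mul_assoc, Matrix.mul_apply]
  refine Finset.sum_congr rfl fun j _ => ?_
  rw [inner_smul_left, hdual, Matrix.conjTranspose_apply, Complex.star_def]

theorem IsPosDefSolution.sqrt_diag_pos {G : Matrix (Fin n) (Fin n) ℂ} (hX : IsPosDefSolution G X)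
    (i : Fin n) : 0 < √(X i i).re :=
  Real.sqrt_pos.2 (Complex.lt_def.1 (hX.posDef.diag_pos (i := i))).1

theorem IsPosDefSolution.ofReal_sqrt_mul_self {G : Matrix (Fin n) (Fin n) ℂ}
    (hX : IsPosDefSolution G X) (i : Fin n) :
    ((√(X i i).re : ℝ) : ℂ) * ((√(X i i).re : ℝ) : ℂ) = X i i := by
  have h := Complex.lt_def.1 (hX.posDef.diag_pos (i := i))
  rw [← Complex.ofReal_mul, Real.mul_self_sqrt h.1.le]
  exact Complex.ext (by simp) (by simpa using h.2)

theorem IsPosDefSolution.isUnit_det_sqrtDiag {G : Matrix (Fin n) (Fin n) ℂ}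
    (hX : IsPosDefSolution G X) : IsUnit (sqrtDiag X).det := by
  rw [sqrtDiag, Matrix.det_diagonal, isUnit_iff_ne_zero, Finset.prod_ne_zero_iff]
  exact fun i _ => by exact_mod_cast (hX.sqrt_diag_pos i).ne'

theorem sqrtDiag_isHermitian (X : Matrix (Fin n) (Fin n) ℂ) : (sqrtDiag X).IsHermitian :=
  Matrix.isHermitian_diagonal_of_self_adjoint _ (by ext i; simp)

theorem IsPosDefSolution.mul_conjTranspose {G : Matrix (Fin n) (Fin n) ℂ}
    (hX : IsPosDefSolution G X) :
    ((sqrtDiag X)⁻¹ * X) * ((sqrtDiag X)⁻¹ * X).conjTranspose = G := by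
  have hu := hX.isUnit_det_sqrtDiag
  rw [Matrix.conjTranspose_mul, hX.posDef.isHermitian, (sqrtDiag_isHermitian X).inv]
  calc (sqrtDiag X)⁻¹ * X * (X * (sqrtDiag X)⁻¹)
      = (sqrtDiag X)⁻¹ * X ^ 2 * (sqrtDiag X)⁻¹ := by rw [sq]; simp only [Matrix.mul_assoc]
    _ = ((sqrtDiag X)⁻¹ * sqrtDiag X) * G * (sqrtDiag X * (sqrtDiag X)⁻¹) := by
        rw [hX.sq_eq]; simp only [Matrix.mul_assoc]
    _ = G := by rw [Matrix.nonsing_inv_mul _ hu, Matrix.mul_nonsing_inv _ hu]; simp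

theorem apply_eq_sqrt_mul_inner_basisOf (hp : ∀ i, 0 < p i) (hψ : LinearIndependent ℂ ψ)
    (hX : IsPosDefSolution (gramMatrix p ψ) X) (i k : Fin n) :
    X i k = (√(X i i).re : ℝ) * ⟪scaledState p ψ i, basisOf p ψ X k⟫_ℂ := by
  rw [basisOf, inner_scaledState_sum_dualState hp hψ]
  conv_lhs => rw [← Matrix.mul_nonsing_inv_cancel_left _ X hX.isUnit_det_sqrtDiag]
  conv_lhs => rw [sqrtDiag, Matrix.diagonal_mul]
  rfl

theorem inner_basisOf_self (hp : ∀ i, 0 < p i) (hψ : LinearIndependent ℂ ψ)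
    (hX : IsPosDefSolution (gramMatrix p ψ) X) (i : Fin n) :
    ⟪scaledState p ψ i, basisOf p ψ X i⟫_ℂ = (√(X i i).re : ℝ) := by
  have h0 : ((√(X i i).re : ℝ) : ℂ) ≠ 0 := by exact_mod_cast (hX.sqrt_diag_pos i).ne'
  refine mul_left_cancel₀ h0 ?_
  rw [← apply_eq_sqrt_mul_inner_basisOf hp hψ hX, hX.ofReal_sqrt_mul_self]

theorem orthonormal_basisOf (hp : ∀ i, 0 < p i) (hψ : LinearIndependent ℂ ψ)
    (hX : IsPosDefSolution (gramMatrix p ψ) X) : Orthonormal ℂ (basisOf p ψ X) :=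
  orthonormal_sum_dualState hp hψ hX.mul_conjTranspose

/-- A projector fixes its vector only up to phase; positivity of `⟪φ i, w i⟫` fixes the phase, since
`E i (φ i) = √(X i i) • w i`. -/
theorem IsPosDefSolution.eq_of_rankOneFamily_eq {X' : Matrix (Fin n) (Fin n) ℂ}
    (hp : ∀ i, 0 < p i) (hψ : LinearIndependent ℂ ψ)
    (hX : IsPosDefSolution (gramMatrix p ψ) X) (hX' : IsPosDefSolution (gramMatrix p ψ) X')
    (h : rankOneFamily (basisOf p ψ X) = rankOneFamily (basisOf p ψ X')) : X = X' := by
  have happ : ∀ {Y : Matrix (Fin n) (Fin n) ℂ}, IsPosDefSolution (gramMatrix p ψ) Y → ∀ i,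
      rankOneFamily (basisOf p ψ Y) i (scaledState p ψ i) =
        ((√(Y i i).re : ℝ) : ℂ) • basisOf p ψ Y i := fun hY i => by
    rw [rankOneFamily, InnerProductSpace.rankOne_apply, ← inner_conj_symm,
      inner_basisOf_self hp hψ hY, Complex.conj_ofReal]
  have hdiag : ∀ {Y : Matrix (Fin n) (Fin n) ℂ}, IsPosDefSolution (gramMatrix p ψ) Y → ∀ i,
      ⟪scaledState p ψ i, rankOneFamily (basisOf p ψ Y) i (scaledState p ψ i)⟫_ℂ = Y i i :=
    fun hY i => by
      rw [happ hY, inner_smul_right, inner_basisOf_self hp hψ hY, hY.ofReal_sqrt_mul_self]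
  have hii : ∀ i, X i i = X' i i := fun i => by rw [← hdiag hX, ← hdiag hX', h]
  have hw : ∀ i, basisOf p ψ X i = basisOf p ψ X' i := fun i => by
    have h0 : ((√(X i i).re : ℝ) : ℂ) ≠ 0 := by exact_mod_cast (hX.sqrt_diag_pos i).ne'
    have h1 := happ hX i
    rw [h, happ hX', ← hii] at h1
    exact (smul_right_injective H h0 h1).symm
  ext i k
  rw [apply_eq_sqrt_mul_inner_basisOf hp hψ hX, apply_eq_sqrt_mul_inner_basisOf hp hψ hX', hii, hw]

variable [FiniteDimensional ℂ H]

theorem exists_orthonormalBasis_coe_eq (hdim : Module.finrank ℂ H = n) {w : Fin n → H}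
    (hw : Orthonormal ℂ w) : ∃ b : OrthonormalBasis (Fin n) ℂ H, ⇑b = w :=
  ⟨OrthonormalBasis.mk hw
    (hw.linearIndependent.span_eq_top_of_card_eq_finrank' (by simp [hdim])).ge, by simp⟩

theorem isOptimalPOVM_basisOf (hdim : Module.finrank ℂ H = n) (hp : ∀ i, 0 < p i)
    (hψ : LinearIndependent ℂ ψ) (hX : IsPosDefSolution (gramMatrix p ψ) X) :
    IsOptimalPOVM p ψ (rankOneFamily (basisOf p ψ X)) ∧
      ∀ E : Fin n → H →L[ℂ] H, IsOptimalPOVM p ψ E → E = rankOneFamily (basisOf p ψ X) := by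
  obtain ⟨b, hb⟩ := exists_orthonormalBasis_coe_eq hdim (orthonormal_basisOf hp hψ hX)
  have hdφ := inner_basisOf_self hp hψ hX
  have hXφ := apply_eq_sqrt_mul_inner_basisOf hp hψ hX
  rw [← hb] at hdφ hXφ ⊢
  have hval := sum_re_inner_rankOneFamily hdφ hXφ
  have hcert := fun {F : Fin n → H →L[ℂ] H} (hF : IsPOVM F) =>
    sum_re_inner_le_trace hX.posDef hX.sqrt_diag_pos hdφ hXφ hF
  refine ⟨⟨rankOneFamily_isPOVM b, fun F hF => ?_⟩, fun E hE => ?_⟩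
  · rw [successProb_eq_sum_scaledState hp, successProb_eq_sum_scaledState hp, hval]
    exact (hcert hF).1
  · have h := hE.2 _ (rankOneFamily_isPOVM b)
    rw [successProb_eq_sum_scaledState hp, successProb_eq_sum_scaledState hp, hval] at h
    exact (hcert hE.1).2 (le_antisymm (hcert hE.1).1 h)

end Solution

/-! ### Existence of a solution by maximization -/

section Existence

variable {n : ℕ} {H : Type*} [NormedAddCommGroup H] [InnerProductSpace ℂ H]

theorem isCompact_setOf_orthonormal [FiniteDimensional ℂ H] :
    IsCompact {w : Fin n → H | Orthonormal ℂ w} := by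
  refine Metric.isCompact_of_isClosed_isBounded ?_ ?_
  · simp only [orthonormal_iff_ite, Set.ofPred_forall]
    exact isClosed_iInter fun i => isClosed_iInter fun j =>
      isClosed_eq (by fun_prop) continuous_const
  · refine (Metric.isBounded_closedBall (x := (0 : Fin n → H)) (r := 1)).subset fun w hw => ?_
    rw [mem_closedBall_zero_iff, pi_norm_le_iff_of_nonneg zero_le_one]
    exact fun i => (hw.1 i).le

theorem orthonormal_smul_of_norm_eq_one {w : Fin n → H} (hw : Orthonormal ℂ w) {c : Fin n → ℂ}
    (hc : ∀ i, ‖c i‖ = 1) : Orthonormal ℂ fun i => c i • w i :=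
  ⟨fun i => by rw [norm_smul, hc, hw.1, one_mul], fun i j hij => by
    simp only [inner_smul_left, inner_smul_right, hw.2 hij, mul_zero]⟩

/-- There is an orthonormal family maximizing `∑ i, |⟨φ i|w i⟩|²` with all overlaps `⟨φ i|w i⟩`
real and nonnegative. -/
theorem exists_orthonormal_maximizer [FiniteDimensional ℂ H] (hdim : Module.finrank ℂ H = n)
    (φ : Fin n → H) :
    ∃ (w : Fin n → H) (d : Fin n → ℝ), Orthonormal ℂ w ∧ (∀ i, 0 ≤ d i) ∧
      (∀ i, ⟪φ i, w i⟫_ℂ = d i) ∧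
      ∀ v : Fin n → H, Orthonormal ℂ v → ∑ i, ‖⟪φ i, v i⟫_ℂ‖ ^ 2 ≤ ∑ i, d i ^ 2 := by
  obtain ⟨w, hw, hmax⟩ := (isCompact_setOf_orthonormal (n := n) (H := H)).exists_isMaxOn
    ⟨(stdOrthonormalBasis ℂ H).reindex (finCongr hdim), OrthonormalBasis.orthonormal _⟩
    (f := fun w => ∑ i, ‖⟪φ i, w i⟫_ℂ‖ ^ 2) (by fun_prop)
  choose c hc hcw using fun i => Complex.exists_norm_mul_eq_self ⟪φ i, w i⟫_ℂ
  refine ⟨fun i => (starRingEnd ℂ) (c i) • w i, fun i => ‖⟪φ i, w i⟫_ℂ‖,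
    orthonormal_smul_of_norm_eq_one hw fun i => by rw [RCLike.norm_conj, hc],
    fun i => norm_nonneg _, fun i => ?_, fun v hv => hmax hv⟩
  rw [inner_smul_right, ← hcw i, ← mul_assoc, Complex.conj_mul', hc]
  simp

/-- Multiplying the component along a unit vector `v` by the phase `z` preserves
orthonormality. -/
theorem orthonormal_add_phase {w : Fin n → H} (hw : Orthonormal ℂ w) {v : H} (hv : ‖v‖ = 1)
    {z : ℂ} (hz : ‖z‖ = 1) :
    Orthonormal ℂ fun i => w i + ((z - 1) * ⟪v, w i⟫_ℂ) • v := by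
  have hvv : ⟪v, v⟫_ℂ = 1 := by rw [inner_self_eq_norm_sq_to_K, hv]; simp
  have hzz : (starRingEnd ℂ) z * z = 1 := by rw [Complex.conj_mul', hz]; simp
  rw [orthonormal_iff_ite] at hw ⊢
  intro i j
  rw [← hw i j]
  simp only [inner_add_left, inner_add_right, inner_smul_left, inner_smul_right, hvv, map_mul,
    map_sub, map_one, inner_conj_symm]
  linear_combination ⟪w i, v⟫_ℂ * ⟪v, w j⟫_ℂ * hzz

theorem nonneg_of_forall_re_phase_sub_one_mul_nonpos {t : ℂ}
    (h : ∀ z : ℂ, ‖z‖ = 1 → ((z - 1) * t).re ≤ 0) : 0 ≤ t := by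
  -- Test with the conjugate phase of `t`: this gives `‖t‖ ≤ t.re`.
  obtain ⟨c, hc, hct⟩ := Complex.exists_norm_mul_eq_self t
  have h1 := h ((starRingEnd ℂ) c) (by rw [RCLike.norm_conj, hc])
  have h2 : (starRingEnd ℂ) c * t = ‖t‖ := by
    conv_lhs => rw [← hct]
    rw [← mul_assoc, Complex.conj_mul', hc]
    simp
  rw [sub_mul, h2, one_mul, Complex.sub_re, Complex.ofReal_re] at h1
  rw [← Complex.re_eq_norm]
  exact le_antisymm (Complex.re_le_norm t) (by linarith)

variable {φ w : Fin n → H} {d : Fin n → ℝ}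

/-- By AM-GM, a maximum of the quadratic functional also bounds its linearization, so variations can
be tested without derivatives. -/
theorem sum_mul_re_inner_le (hd : ∀ i, 0 ≤ d i)
    (hmax : ∀ v : Fin n → H, Orthonormal ℂ v → ∑ i, ‖⟪φ i, v i⟫_ℂ‖ ^ 2 ≤ ∑ i, d i ^ 2)
    {v : Fin n → H} (hv : Orthonormal ℂ v) :
    (∑ i, (d i : ℂ) * ⟪φ i, v i⟫_ℂ).re ≤ ∑ i, d i ^ 2 := by
  have h : ∀ i, ((d i : ℂ) * ⟪φ i, v i⟫_ℂ).re ≤ (d i ^ 2 + ‖⟪φ i, v i⟫_ℂ‖ ^ 2) / 2 := fun i => by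
    rw [Complex.re_ofReal_mul]
    have := mul_le_mul_of_nonneg_left (Complex.re_le_norm ⟪φ i, v i⟫_ℂ) (hd i)
    linarith [two_mul_le_add_sq (d i) ‖⟪φ i, v i⟫_ℂ‖]
  rw [Complex.re_sum]
  refine (Finset.sum_le_sum fun i _ => h i).trans ?_
  rw [← Finset.sum_div, Finset.sum_add_distrib]
  linarith [hmax v hv]

/-- The operator `∑ i, d i |w i⟩⟨φ i|`. -/
noncomputable def overlapOperator (φ w : Fin n → H) (d : Fin n → ℝ) : H →L[ℂ] H :=
  ∑ i, (d i : ℂ) • InnerProductSpace.rankOne ℂ (w i) (φ i)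

theorem inner_overlapOperator (x y : H) :
    ⟪x, overlapOperator φ w d y⟫_ℂ = ∑ i, (d i : ℂ) * (⟪φ i, y⟫_ℂ * ⟪x, w i⟫_ℂ) := by
  simp [overlapOperator]

theorem inner_overlapOperator_of_orthonormal (hw : Orthonormal ℂ w) (i : Fin n) (y : H) :
    ⟪w i, overlapOperator φ w d y⟫_ℂ = (d i : ℂ) * ⟪φ i, y⟫_ℂ := by
  simp [inner_overlapOperator, orthonormal_iff_ite.1 hw]

/-- Rotating the component along a unit vector `v` by a phase `z` changes the linearized functional
by `Re ((z - 1) * ⟪v, T v⟫)`, where `T` is the operator; this is never positive. -/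
theorem overlapOperator_isPositive (hw : Orthonormal ℂ w) (hd : ∀ i, 0 ≤ d i)
    (hdφ : ∀ i, ⟪φ i, w i⟫_ℂ = d i)
    (hmax : ∀ v : Fin n → H, Orthonormal ℂ v → ∑ i, ‖⟪φ i, v i⟫_ℂ‖ ^ 2 ≤ ∑ i, d i ^ 2) :
    (overlapOperator φ w d).IsPositive := by
  have hunit : ∀ v : H, ‖v‖ = 1 → 0 ≤ ⟪v, overlapOperator φ w d v⟫_ℂ := fun v hv => by
    refine nonneg_of_forall_re_phase_sub_one_mul_nonpos fun z hz => ?_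
    have h := sum_mul_re_inner_le hd hmax (orthonormal_add_phase hw hv hz)
    have hexp : ∑ i, (d i : ℂ) * ⟪φ i, w i + ((z - 1) * ⟪v, w i⟫_ℂ) • v⟫_ℂ =
        ((∑ i, d i ^ 2 : ℝ) : ℂ) + (z - 1) * ⟪v, overlapOperator φ w d v⟫_ℂ := by
      rw [inner_overlapOperator, Finset.mul_sum, Complex.ofReal_sum, ← Finset.sum_add_distrib]
      refine Finset.sum_congr rfl fun i _ => ?_
      rw [inner_add_right, inner_smul_right, hdφ]
      push_cast
      ring
    rw [hexp, Complex.add_re, Complex.ofReal_re] at h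
    linarith
  have hall : ∀ v : H, 0 ≤ ⟪v, overlapOperator φ w d v⟫_ℂ := fun v => by
    rcases eq_or_ne v 0 with rfl | hv
    · simp
    have h := hunit ((‖v‖⁻¹ : ℂ) • v) (norm_smul_inv_norm hv)
    have hn : (0 : ℂ) < ‖v‖ * ‖v‖ := by
      have := norm_pos_iff.2 hv
      exact_mod_cast mul_pos this this
    have hn0 : (‖v‖ : ℂ) ≠ 0 := by exact_mod_cast (norm_pos_iff.2 hv).ne'
    have h' := mul_nonneg hn.le h
    rw [map_smul, inner_smul_left, inner_smul_right, map_inv₀, Complex.conj_ofReal] at h'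
    convert h' using 1
    field_simp
  rw [ContinuousLinearMap.isPositive_iff_complex]
  intro x
  have hx := hall x
  rw [← inner_conj_symm, Complex.nonneg_iff, Complex.conj_re, Complex.conj_im] at hx
  exact ⟨Complex.ext (by simp) (by simp [neg_eq_zero.1 hx.2.symm]), hx.1⟩

theorem overlap_pos (hφ : Submodule.span ℂ (Set.range φ) = ⊤) (hw : Orthonormal ℂ w)
    (hd : ∀ i, 0 ≤ d i) (hdφ : ∀ i, ⟪φ i, w i⟫_ℂ = d i)
    (hmax : ∀ v : Fin n → H, Orthonormal ℂ v → ∑ i, ‖⟪φ i, v i⟫_ℂ‖ ^ 2 ≤ ∑ i, d i ^ 2)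
    (s : Fin n) : 0 < d s := by
  refine (hd s).lt_of_ne' fun hs => ?_
  -- If `d i = 0`, exchanging `w i` and `w s` gives up only zero terms, so maximality allows no
  -- gain. If `d i ≠ 0`, symmetry of the operator gives `d i * ⟪φ i, w s⟫ = conj (d s * ⟪φ s, w i⟫)
  -- = 0`.
  have horth : ∀ i, ⟪φ i, w s⟫_ℂ = 0 := fun i => by
    by_cases hi : d i = 0
    · rcases eq_or_ne i s with rfl | his
      · rw [hdφ, hi, Complex.ofReal_zero]
      have h := hmax (w ∘ Equiv.swap i s) (hw.comp _ (Equiv.injective _))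
      have hle : ∀ j ∈ Finset.univ, d j ^ 2 ≤ ‖⟪φ j, (w ∘ Equiv.swap i s) j⟫_ℂ‖ ^ 2 := fun j _ => by
        rcases eq_or_ne j i with rfl | hji
        · rw [hi, zero_pow two_ne_zero]; positivity
        rcases eq_or_ne j s with rfl | hjs
        · rw [hs, zero_pow two_ne_zero]; positivity
        · rw [Function.comp_apply, Equiv.swap_apply_of_ne_of_ne hji hjs, hdφ]
          simp
      have heq := (Finset.sum_eq_sum_iff_of_le hle).1 (le_antisymm (Finset.sum_le_sum hle) h) i
        (Finset.mem_univ i)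
      rw [Function.comp_apply, Equiv.swap_apply_left, hi] at heq
      simpa using heq.symm
    · have hpos := (overlapOperator_isPositive hw hd hdφ hmax).isSymmetric (w i) (w s)
      rw [ContinuousLinearMap.coe_coe, ← inner_conj_symm, inner_overlapOperator_of_orthonormal hw,
        inner_overlapOperator_of_orthonormal hw, hs] at hpos
      simpa [hi] using hpos.symm
  have hzero : w s = 0 := by
    have hle : Submodule.span ℂ (Set.range φ) ≤ (ℂ ∙ w s)ᗮ := by
      rw [Submodule.span_le]
      rintro _ ⟨i, rfl⟩
      exact Submodule.mem_orthogonal_singleton_iff_inner_left.2 (horth i)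
    exact inner_self_eq_zero.1 (Submodule.mem_orthogonal_singleton_iff_inner_left.1
      (hle (hφ ▸ Submodule.mem_top)))
  exact hw.ne_zero s hzero

theorem exists_isPosDefSolution [FiniteDimensional ℂ H] (hdim : Module.finrank ℂ H = n)
    {p : Fin n → ℝ} {ψ : Fin n → H} (hp : ∀ i, 0 < p i) (hψ : LinearIndependent ℂ ψ) :
    ∃ X : Matrix (Fin n) (Fin n) ℂ, IsPosDefSolution (gramMatrix p ψ) X := by
  set φ := scaledState p ψ with hφdef
  have hφ : Submodule.span ℂ (Set.range φ) = ⊤ :=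
    (linearIndependent_scaledState hp hψ).span_eq_top_of_card_eq_finrank' (by simp [hdim])
  obtain ⟨w, d, hw, hd, hdφ, hmax⟩ := exists_orthonormal_maximizer hdim φ
  have hdpos := overlap_pos hφ hw hd hdφ hmax
  obtain ⟨b, rfl⟩ := exists_orthonormalBasis_coe_eq hdim hw
  set X := LinearMap.toMatrixOrthonormal b (overlapOperator φ b d : H →ₗ[ℂ] H) with hXdef
  have hX : ∀ i j, X i j = d i * ⟪φ i, b j⟫_ℂ := fun i j => by
    rw [hXdef, LinearMap.toMatrixOrthonormal_apply_apply]
    exact inner_overlapOperator_of_orthonormal hw i (b j)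
  have hpsd : X.PosSemidef := (LinearMap.posSemidef_toMatrix_iff b).2
    ((ContinuousLinearMap.isPositive_toLinearMap_iff _).2
      (overlapOperator_isPositive hw hd hdφ hmax))
  have hD : sqrtDiag X = Matrix.diagonal fun i => (d i : ℂ) := by
    rw [sqrtDiag]
    congr 1
    funext i
    rw [hX, hdφ, ← Complex.ofReal_mul, Complex.ofReal_re, Real.sqrt_mul_self (hd i)]
  have hsq : X ^ 2 = sqrtDiag X * gramMatrix p ψ * sqrtDiag X := by
    -- In this form the entries follow from Parseval in the basis `b`.
    have h : X ^ 2 = X * X.conjTranspose := by rw [hpsd.isHermitian, sq]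
    rw [h, hD]
    ext i j
    rw [Matrix.mul_diagonal, Matrix.diagonal_mul, gramMatrix, Matrix.gram_apply, ← hφdef,
      ← b.sum_inner_mul_inner, Matrix.mul_apply, Finset.mul_sum, Finset.sum_mul]
    refine Finset.sum_congr rfl fun k _ => ?_
    rw [Matrix.conjTranspose_apply, hX, hX, star_mul', Complex.star_def, Complex.conj_ofReal,
      inner_conj_symm]
    ring
  have hDu : IsUnit (sqrtDiag X) := by
    rw [Matrix.isUnit_iff_isUnit_det, hD, Matrix.det_diagonal, isUnit_iff_ne_zero,
      Finset.prod_ne_zero_iff]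
    exact fun i _ => by exact_mod_cast (hdpos i).ne'
  -- Definiteness comes from invertibility of `X ^ 2 = D G D`, hence from `d i > 0`.
  refine ⟨X, hpsd.posDef_iff_isUnit.2 ?_, hsq⟩
  rw [← isUnit_pow_iff two_ne_zero, hsq]
  exact (hDu.mul (gramMatrix_posDef hp hψ).isUnit).mul hDu

end Existence

end MED

theorem theorem2 {n : ℕ} {H : Type*} [NormedAddCommGroup H] [InnerProductSpace ℂ H]
    [FiniteDimensional ℂ H] (hdim : Module.finrank ℂ H = n)
    (p : Fin n → ℝ) (ψ : Fin n → H)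
    (hp : ∀ i, 0 < p i) (hp_sum : ∑ i, p i = 1)
    (hψ_norm : ∀ i, ‖ψ i‖ = 1) (hψ : LinearIndependent ℂ ψ) :
    -- a positive definite solution yields an orthonormal basis whose projectors are the
    -- (unique) optimal POVM
    (∀ X : Matrix (Fin n) (Fin n) ℂ, MED.IsPosDefSolution (MED.gramMatrix p ψ) X →
      Orthonormal ℂ (MED.basisOf p ψ X) ∧
      MED.IsOptimalPOVM p ψ (MED.rankOneFamily (MED.basisOf p ψ X)) ∧
      ∀ E : Fin n → H →L[ℂ] H, MED.IsOptimalPOVM p ψ E →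
        E = MED.rankOneFamily (MED.basisOf p ψ X)) ∧
    -- the positive definite solution is unique
    (∀ X X' : Matrix (Fin n) (Fin n) ℂ, MED.IsPosDefSolution (MED.gramMatrix p ψ) X →
      MED.IsPosDefSolution (MED.gramMatrix p ψ) X' → X = X') ∧
    -- necessary and sufficient conditions for optimality
    (∀ E : Fin n → H →L[ℂ] H, MED.IsOptimalPOVM p ψ E ↔
      ∃ X : Matrix (Fin n) (Fin n) ℂ, MED.IsPosDefSolution (MED.gramMatrix p ψ) X ∧
        E = MED.rankOneFamily (MED.basisOf p ψ X)) := by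
  have hopt := fun X hX => MED.isOptimalPOVM_basisOf (X := X) hdim hp hψ hX
  refine ⟨fun X hX => ⟨MED.orthonormal_basisOf hp hψ hX, hopt X hX⟩, fun X X' hX hX' => ?_,
    fun E => ⟨fun hE => ?_, ?_⟩⟩
  · exact hX.eq_of_rankOneFamily_eq hp hψ hX' ((hopt X' hX').2 _ (hopt X hX).1)
  · obtain ⟨X, hX⟩ := MED.exists_isPosDefSolution hdim hp hψ
    exact ⟨X, hX, (hopt X hX).2 E hE⟩
  · rintro ⟨X, hX, rfl⟩
    exact (hopt X hX).1
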